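/- **Model.** The deterministic Congested Clique on $n$ nodes with identifiers $1,\dots,n$: in each synchronous round every node sends one message of $O(\log n)$ bits to every other node; local computation is unrestricted, and $n,k,h,i$ are known to all nodes. Graphs are simple directed graphs on the $n$ nodes whose edge weights are positive integers bounded by a polynomial in $n$, and each node initially knows exactly its incident (incoming and outgoing) edges, with their weights, of each input graph. **Notions.** The hops of a path are its edges, its length is the sum of its edge weights. $d_G(u,v)$ is the minimum length of a path from $u$ to $v$ in $G$, and the $q$-hop distance is the minimum length of such a path with at most $q$ hops ($\infty$ if there is none). $N_k(v)$ (resp. $N_k^q(v)$) is the set of the $k$ nodes $u$ with the smallest distance (resp. $q$-hop distance) from $v$ to $u$, ties broken by identifiers (all nodes if $k\ge n$; note $v\in N_k(v)$ for $k \geq 1$). A graph $H$ on the nodes of $G$ is a *$k$-nearest $\beta$-hopset* for $G$ if $d_G(u,v)=d_{G\cup H}(u,v)$ for all $u,v$, and for all $u$ and all $v\in N_k(u)$ with $d_G(u,v)<\infty$ there is a path from $u$ to $v$ in $G\cup H$ with at most $\beta$ hops and length exactly $d_G(u,v)$. **Lemma 3.3 (Computing $k$-nearest nodes).** Let $k,h,i$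 be positive integers with $k\in O(n^{1/h})$. 1. Given a weighted directed graph $G$ and a $k$-nearest $h^i$-hopset $H$ for $G$, there is a deterministic Congested Clique algorithm in which, after $O(i)$ rounds, each node $v$ knows $N_k(v)$ and the exact distances $d_G(v,u)$ to all $u\in N_k(v)$. 2. Given a weighted directed graph $G$ (and no hopset), there is a deterministic Congested Clique algorithm in which, after $O(i)$ rounds, each node $v$ knows $N_k^{h^i}(v)$ and the $h^i$-hop distances from $v$ to all $u\in N_k^{h^i}(v)$. Precisely: for every $c$ there is $b$ such that for every $C$ there is $D$ such that for all $n$ and all positive integers $k,h,i$ with $k\le C n^{1/h}$ there are such algorithms, using messages of $b(\lfloor\log_2 n\rfloor+1)$ bits and at most $D\cdot i$ rounds, that are correct for all inputs with edge weights at most $n^c$. -/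

import Mathlib

/-- A simple weighted directed graph on the node set `{0, …, n-1}` (the node is its own identifier)
with positive integer weights; `weight u v = ⊤` means that there is no edge from `u` to `v`. -/
structure WDigraph (n : ℕ) where
  weight : Fin n → Fin n → ℕ∞
  loopless : ∀ v, weight v v = ⊤
  pos : ∀ u v, 0 < weight u v

namespace WDigraph

variable {n : ℕ}

/-- Every edge of `G` has weight at most `W`. -/
def WeightsLE (G : WDigraph n) (W : ℕ) : Prop :=
  ∀ u v, G.weight u v ≠ ⊤ → G.weight u v ≤ (W : ℕ∞)

/-- The union of two graphs on the same node set; of two parallel edges the lighter one is kept. -/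
noncomputable def union (G H : WDigraph n) : WDigraph n where
  weight u v := min (G.weight u v) (H.weight u v)
  loopless v := by simp [G.loopless, H.loopless]
  pos u v := lt_min (G.pos u v) (H.pos u v)

/-- `G.HasPath u v t l`: there is a directed path from `u` to `v` in `G` with exactly `t` hops
and length `l`. -/
inductive HasPath (G : WDigraph n) : Fin n → Fin n → ℕ → ℕ → Prop
  | nil (u : Fin n) : HasPath G u u 0 0
  | cons {u x v : Fin n} {w t l : ℕ} :
      G.weight u x = (w : ℕ∞) → HasPath G x v t l → HasPath G u v (t + 1) (w + l)

/-- The distance from `u` to `v`: the minimum length of a path, `⊤` if there is none. -/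
noncomputable def dist (G : WDigraph n) (u v : Fin n) : ℕ∞ :=
  sInf {x : ℕ∞ | ∃ t l : ℕ, G.HasPath u v t l ∧ x = (l : ℕ∞)}

/-- The `q`-hop distance from `u` to `v`: the minimum length of a path with at most `q` hops,
`⊤` if there is none. -/
noncomputable def hopDist (G : WDigraph n) (q : ℕ) (u v : Fin n) : ℕ∞ :=
  sInf {x : ℕ∞ | ∃ t l : ℕ, t ≤ q ∧ G.HasPath u v t l ∧ x = (l : ℕ∞)}

end WDigraph

/-- The `k` nodes with the smallest values of `f`, ties broken by identifiers
(all nodes if `k ≥ n`): those nodes that fewer than `k` nodes precede. -/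
noncomputable def kSmallest {n : ℕ} (k : ℕ) (f : Fin n → ℕ∞) : Finset (Fin n) :=
  open Classical in
  Finset.univ.filter fun v =>
    (Finset.univ.filter fun u => f u < f v ∨ (f u = f v ∧ u < v)).card < k

namespace WDigraph

variable {n : ℕ}

/-- `N_k(v)`: the `k` nearest nodes, with respect to the distances from `v`. -/
noncomputable def kNearest (G : WDigraph n) (k : ℕ) (v : Fin n) : Finset (Fin n) :=
  kSmallest k (G.dist v)

/-- `N_k^q(v)`: the `k` nearest nodes, with respect to the `q`-hop distances from `v`. -/
noncomputable def kNearestHop (G : WDigraph n) (k q : ℕ) (v : Fin n) : Finset (Fin n) :=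
  kSmallest k (G.hopDist q v)

/-- `H` is a `k`-nearest `β`-hopset for `G`. The path is asked for only if `v` can be reached
from `u` at all (`N_k(u)` contains unreachable nodes if fewer than `k` nodes are reachable). -/
structure IsKNearestHopset (k β : ℕ) (G H : WDigraph n) : Prop where
  dist_eq : ∀ u v, G.dist u v = (G.union H).dist u v
  path : ∀ u, ∀ v ∈ G.kNearest k u, ∀ d : ℕ, G.dist u v = (d : ℕ∞) →
    ∃ t ≤ β, (G.union H).HasPath u v t d

/-- The set of the pairs `(u, d(v, u))` with `u ∈ N_k(v)`. -/
noncomputable def nearestDistances (G : WDigraph n) (k : ℕ) (v : Fin n) :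
    Finset (Fin n × ℕ∞) :=
  open Classical in (G.kNearest k v).image fun u => (u, G.dist v u)

/-- The set of the pairs `(u, d^q(v, u))` with `u ∈ N_k^q(v)`, `d^q` the `q`-hop distance. -/
noncomputable def nearestHopDistances (G : WDigraph n) (k q : ℕ) (v : Fin n) :
    Finset (Fin n × ℕ∞) :=
  open Classical in (G.kNearestHop k q v).image fun u => (u, G.hopDist q v u)

end WDigraph

/-- What a node knows of a graph initially: its outgoing and incoming edges with their weights. -/
structure IncidentEdges (n : ℕ) where
  outgoing : Fin n → ℕ∞
  incoming : Fin n → ℕ∞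

/-- The edges of `G` incident to `v`. -/
def WDigraph.incident {n : ℕ} (G : WDigraph n) (v : Fin n) : IncidentEdges n where
  outgoing u := G.weight v u
  incoming u := G.weight u v

/-- A deterministic algorithm on a clique of `n` nodes with messages of `B` bits. In each
synchronous round every node sends one message to each node, as a function of its own state,
and updates its state from the messages it receives. Local computation is unrestricted. -/
structure CliqueAlgorithm (n B : ℕ) (Input Output : Type) where
  State : Type
  init : Fin n → Input → State
  send : Fin n → State → (receiver : Fin n) → (Fin B → Bool)
  receive : Fin n → State → ((sender : Fin n) → (Fin B → Bool)) → State
  output : Fin n → State → Output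

namespace CliqueAlgorithm

variable {n B : ℕ} {Input Output : Type}

/-- The state of every node after `T` rounds. -/
def stateAfter (A : CliqueAlgorithm n B Input Output) (inp : Fin n → Input) :
    ℕ → Fin n → A.State
  | 0, v => A.init v (inp v)
  | T + 1, v => A.receive v (A.stateAfter inp T v) fun u => A.send u (A.stateAfter inp T u) v

/-- The output of node `v` after `T` rounds. -/
def outputAfter (A : CliqueAlgorithm n B Input Output) (inp : Fin n → Input) (T : ℕ)
    (v : Fin n) : Output :=
  A.output v (A.stateAfter inp T v)

end CliqueAlgorithm

/-- The message size `b · (⌊log₂ n⌋ + 1)`, in bits. -/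
def messageBits (b n : ℕ) : ℕ := b * (Nat.log 2 n + 1)

/-! Let `W` be the matrix of one-hop distances with zero diagonal. Its `q`-th min-plus power holds
the `q`-hop distances, and the power `h ^ (i + 1)` is the `h`-th power of the power `h ^ i`. So it
suffices to pass, in a number of rounds depending only on `C`, from the `k` smallest entries in each
row of a matrix to those of its `h`-th power.

Two facts make this possible. Truncating every row to its `k` smallest entries does not change the
`k` smallest entries of the rows of a power (`minPlusPow_keepSmallest`), so a row costs only `k`
words. And each entry of the `h`-th power is determined by at most `h` rows
(`exists_rows_minPlusPow`). Hence, if node `w` collects the rows in `U w` and every set of at most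
`h` nodes lies in some `U w`, the best of the answers are right.

For such a cover, cut the nodes into `h * m` blocks with `m` about `n ^ (1 / h) / 3` and give each
set of `h` blocks to its own node; there are at most `(3 * m) ^ h ≤ n` of them
(`exists_balanced_cover`). Each node then sends and receives `O(n * k / m) = O(n)` words in a
pattern fixed in advance, which an edge colouring schedules in `O(1)` rounds (`Reach.route`).

A hopset only turns exact distances to the nearest nodes into hop distances in the union
(`IsKNearestHopset.nearestDistances_eq`). -/

/-! ### Composable communication protocols -/

/-- `Reach B T σ τ`: in each instance `i`, nodes that know `σ i v` can get to know `τ i v` in `T`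
rounds with messages of `B` bits. -/
inductive Reach {n : ℕ} (B : ℕ) {ι S' : Type} (τ : ι → Fin n → S') :
    ℕ → (S : Type) → (ι → Fin n → S) → Prop
  | compute {S : Type} {σ : ι → Fin n → S} (f : Fin n → S → S')
      (hf : ∀ i v, τ i v = f v (σ i v)) : Reach B τ 0 S σ
  | round {T : ℕ} {S : Type} {σ : ι → Fin n → S} (send : Fin n → S → Fin n → Fin B → Bool)
      (h : Reach B τ T (S × (Fin n → Fin B → Bool))
        (fun i v => (σ i v, fun u => send u (σ i u) v))) : Reach B τ (T + 1) S σ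

namespace Reach

variable {n B T : ℕ} {ι S S' S'' : Type}
  {σ : ι → Fin n → S} {τ : ι → Fin n → S'} {ρ : ι → Fin n → S''}

/-- A reachable family of outputs is computed by a clique algorithm. -/
theorem exists_algorithm (h : Reach B τ T S σ) :
    ∃ A : CliqueAlgorithm n B S S', ∀ i v, A.outputAfter (σ i) T v = τ i v := by
  induction h with
  | compute f hf =>
    exact ⟨⟨_, fun _ s => s, fun _ _ _ _ => false, fun _ s _ => s, f⟩, fun i v => (hf i v).symm⟩
  | @round T S σ send h ih =>
    obtain ⟨A, hA⟩ := ih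
    -- `Sum.inl` marks the state before the first round. That round enters `A` with the received
    -- messages as part of its input; the messages in the `Sum.inl` case of `output` are a dummy
    -- value.
    let A' : CliqueAlgorithm n B S S' :=
      { State := S ⊕ A.State
        init := fun _ s => Sum.inl s
        send := fun u s v => s.elim (fun s => send u s v) (fun s => A.send u s v)
        receive := fun v s m =>
          Sum.inr (s.elim (fun s => A.init v (s, m)) (fun s => A.receive v s m))
        output := fun v s =>
          s.elim (fun s => A.output v (A.init v (s, fun _ _ => false))) (A.output v) }
    have key : ∀ i T v, A'.stateAfter (σ i) (T + 1) v =
        Sum.inr (A.stateAfter (fun v => (σ i v, fun u => send u (σ i u) v)) T v) := by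
      intro i T
      induction T with
      | zero => intro v; rfl
      | succ T ih =>
        intro v
        rw [CliqueAlgorithm.stateAfter]
        simp only [ih]
        rfl
    refine ⟨A', fun i v => ?_⟩
    rw [← hA, CliqueAlgorithm.outputAfter, key]
    rfl

theorem of_compute (h : Reach B ρ T S' τ) (f : Fin n → S → S')
    (hf : ∀ i v, τ i v = f v (σ i v)) : Reach B ρ T S σ := by
  induction h generalizing S with
  | compute g hg => exact .compute (fun v s => g v (f v s)) fun i v => by rw [hg, hf]
  | round send _ ih =>
    exact .round (fun u s v => send u (f u s) v)
      (ih (fun v s => (f v s.1, s.2)) fun i v => by simp [hf])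

theorem trans {T' : ℕ} (h : Reach B τ T S σ) (h' : Reach B ρ T' S' τ) :
    Reach B ρ (T + T') S σ := by
  induction h with
  | compute f hf => rw [zero_add]; exact h'.of_compute f hf
  | round send _ ih => rw [Nat.succ_add]; exact .round send ih

theorem then_compute (h : Reach B τ T S σ) (f : Fin n → S' → S'')
    (hf : ∀ i v, ρ i v = f v (τ i v)) : Reach B ρ T S σ :=
  h.trans (.compute f hf)

/-- In `R` rounds every node sends `R` messages to each node. -/
theorem rounds (R : ℕ) (σ : ι → Fin n → S)
    (send : Fin R → Fin n → S → Fin n → Fin B → Bool) :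
    Reach B (fun i v => (σ i v, fun (t : Fin R) (u : Fin n) => send t u (σ i u) v)) R S σ := by
  induction R with
  | zero =>
    exact .compute (fun _ s => (s, fun t => t.elim0)) fun i v => by
      refine Prod.ext rfl (funext fun t => t.elim0)
  | succ R ih =>
    refine (ih fun t => send t.castSucc).trans (.round (fun u s v => send (Fin.last R) u s.1 v) ?_)
    refine .compute (fun _ s => (s.1.1, fun t u => Fin.lastCases (motive := fun _ => _)
      (s.2 u) (fun t => s.1.2 t u) t)) fun i v => ?_
    refine Prod.ext rfl (funext fun t => funext fun u => ?_)
    induction t using Fin.lastCases <;> simp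

end Reach

/-! ### Edge colouring and routing -/

/-- Greedy colouring: a bipartite multigraph of maximum degree at most `L` has a proper edge
colouring with `2 L` colours. -/
theorem exists_edge_colouring {E X Y : Type} [Fintype E] [DecidableEq X] [DecidableEq Y]
    (src : E → X) (dst : E → Y) (L : ℕ)
    (hsrc : ∀ x, (Finset.univ.filter fun e => src e = x).card ≤ L)
    (hdst : ∀ y, (Finset.univ.filter fun e => dst e = y).card ≤ L) :
    ∃ col : E → Fin (2 * L), ∀ e e', col e = col e' → (src e = src e' ∨ dst e = dst e') →
      e = e' := by
  classical
  suffices H : ∀ s : Finset E, ∃ col : E → ℕ, (∀ e ∈ s, col e < 2 * L) ∧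
      ∀ e ∈ s, ∀ e' ∈ s, col e = col e' → (src e = src e' ∨ dst e = dst e') → e = e' by
    obtain ⟨col, h1, h2⟩ := H Finset.univ
    exact ⟨fun e => ⟨col e, h1 e (Finset.mem_univ _)⟩, fun e e' h =>
      h2 e (Finset.mem_univ _) e' (Finset.mem_univ _) (Fin.mk.inj_iff.1 h)⟩
  intro s
  induction s using Finset.induction_on with
  | empty => exact ⟨fun _ => 0, by simp, by simp⟩
  | insert a s ha ih =>
    obtain ⟨col, h1, h2⟩ := ih
    let P := (Finset.univ.filter fun e => src e = src a).erase a
    let Q := (Finset.univ.filter fun e => dst e = dst a).erase a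
    have hP : P.card < L := lt_of_lt_of_le (Finset.card_erase_lt_of_mem (by simp)) (hsrc (src a))
    have hQ : Q.card < L := lt_of_lt_of_le (Finset.card_erase_lt_of_mem (by simp)) (hdst (dst a))
    -- Each end of `a` meets at most `L - 1` other edges, so one of the `2 * L` colours is free.
    have hc : ((P ∪ Q).image col).card < (Finset.range (2 * L)).card := by
      have := (Finset.card_image_le (s := P ∪ Q) (f := col)).trans (Finset.card_union_le P Q)
      rw [Finset.card_range]; omega
    obtain ⟨q, hq, hq'⟩ := Finset.exists_mem_notMem_of_card_lt_card hc
    have hne : ∀ e ∈ s, col e = q → ¬ (src e = src a ∨ dst e = dst a) := by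
      rintro e he rfl h
      have hea : e ≠ a := by rintro rfl; exact ha he
      refine hq' (Finset.mem_image_of_mem _ ?_)
      rcases h with h | h <;> simp [P, Q, hea, h]
    have hup : ∀ e ∈ s, Function.update col a q e = col e := fun e he =>
      Function.update_of_ne (by rintro rfl; exact ha he) _ _
    refine ⟨Function.update col a q, ?_, ?_⟩
    · intro e he
      rcases Finset.mem_insert.1 he with rfl | he
      · simpa using hq
      · rw [hup e he]; exact h1 e he
    · intro e he e' he' h h'
      rcases Finset.mem_insert.1 he with ea | he <;> rcases Finset.mem_insert.1 he' with ea' | he'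
      · rw [ea, ea']
      · rw [hup e' he', ea, Function.update_self] at h
        exact (hne e' he' h.symm (ea ▸ h'.imp Eq.symm Eq.symm)).elim
      · rw [hup e he, ea', Function.update_self] at h
        exact (hne e he h (ea' ▸ h')).elim
      · rw [hup e he, hup e' he'] at h
        exact h2 e he e' he' h h'

/-- Routing of a fixed set `E` of messages, of which every node is the source and the destination
of at most `M n`. -/
theorem Reach.route {n B : ℕ} {ι S E : Type} [Fintype E] (M : ℕ) (src dst : E → Fin n)
    (hsrc : ∀ x, (Finset.univ.filter fun e => src e = x).card ≤ M * n)
    (hdst : ∀ y, (Finset.univ.filter fun e => dst e = y).card ≤ M * n)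
    (σ : ι → Fin n → S) (word : E → S → Fin B → Bool) :
    Reach B (fun i v => (σ i v, fun e => if dst e = v then word e (σ i (src e)) else fun _ => false))
      (4 * M) S σ := by
  classical
  obtain ⟨col, hcol⟩ := exists_edge_colouring src dst (M * n) hsrc hdst
  have hlt : ∀ e, (col e : ℕ) < 2 * M * n := fun e =>
    (col e).2.trans_eq (mul_assoc 2 M n).symm
  have hn : ∀ e, 0 < n := fun e => Nat.pos_of_ne_zero fun h => by have := hlt e; simp [h] at this
  -- A colour below `2 * M * n` encodes an intermediate node and one of `2 * M` rounds. Properness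
  -- says that messages sharing a source or a destination never share both, so no link is used twice
  -- in a round, neither towards the relays nor away from them.
  let relay : E → Fin n := fun e => ⟨col e % n, Nat.mod_lt _ (hn e)⟩
  let time : E → Fin (2 * M) := fun e => ⟨col e / n, Nat.div_lt_of_lt_mul
    ((hlt e).trans_eq (mul_comm _ _))⟩
  have huniq : ∀ e e', relay e = relay e' → time e = time e' →
      (src e = src e' ∨ dst e = dst e') → e = e' := by
    intro e e' h1 h2 h3
    refine hcol e e' (Fin.ext ?_) h3
    have h1 := Fin.mk.inj_iff.1 h1
    have h2 := Fin.mk.inj_iff.1 h2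
    rw [← Nat.div_add_mod (col e) n, ← Nat.div_add_mod (col e') n, h1, h2]
  let up : Fin (2 * M) → Fin n → S → Fin n → Fin B → Bool := fun t u s r =>
    if h : ∃ e, src e = u ∧ relay e = r ∧ time e = t then word h.choose s else fun _ => false
  have hup : ∀ e s, up (time e) (src e) s (relay e) = word e s := by
    intro e s
    have h : ∃ e', src e' = src e ∧ relay e' = relay e ∧ time e' = time e := ⟨e, rfl, rfl, rfl⟩
    have : h.choose = e := huniq _ _ h.choose_spec.2.1 h.choose_spec.2.2 (Or.inl h.choose_spec.1)
    simp only [up]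
    rw [dif_pos h, this]
  let down : Fin (2 * M) → Fin n → S × (Fin (2 * M) → Fin n → Fin B → Bool) → Fin n →
      Fin B → Bool := fun t r s d =>
    if h : ∃ e, dst e = d ∧ relay e = r ∧ time e = t then s.2 t (src h.choose)
    else fun _ => false
  have hdown : ∀ e s, down (time e) (relay e) s (dst e) = s.2 (time e) (src e) := by
    intro e s
    have h : ∃ e', dst e' = dst e ∧ relay e' = relay e ∧ time e' = time e := ⟨e, rfl, rfl, rfl⟩
    have : h.choose = e := huniq _ _ h.choose_spec.2.1 h.choose_spec.2.2 (Or.inr h.choose_spec.1)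
    simp only [down]
    rw [dif_pos h, this]
  have h4 : 4 * M = 2 * M + 2 * M := by ring
  rw [h4]
  refine (Reach.rounds (2 * M) σ up).trans ((Reach.rounds (2 * M) _ down).then_compute
    (fun v s => (s.1.1, fun e => if dst e = v then s.2 (time e) (relay e) else fun _ => false))
    fun i v => Prod.ext rfl (funext fun e => ?_))
  by_cases h : dst e = v
  · subst h
    simp only [if_true, hdown, hup]
  · simp [h]

/-! ### The `k` smallest entries of a row -/

section KSmallest

variable {n : ℕ}

/-- `u` comes before `v` in the order by the values of `f`, with ties broken by identifiers. -/
def Precedes (f : Fin n → ℕ∞) (u v : Fin n) : Prop := f u < f v ∨ (f u = f v ∧ u < v)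

/-- The number of nodes that come before `v`. -/
noncomputable def precedingCount (f : Fin n → ℕ∞) (v : Fin n) : ℕ :=
  open Classical in (Finset.univ.filter fun u => Precedes f u v).card

theorem mem_kSmallest {k : ℕ} {f : Fin n → ℕ∞} {v : Fin n} :
    v ∈ kSmallest k f ↔ precedingCount f v < k := by
  classical
  have h : ∀ s t : Finset (Fin n), (∀ u, u ∈ s ↔ u ∈ t) → (s.card < k ↔ t.card < k) :=
    fun s t hst => by rw [Finset.ext hst]
  rw [kSmallest, precedingCount, Finset.mem_filter, and_iff_right (Finset.mem_univ v)]
  refine h _ _ fun u => Finset.mem_filter.trans (Iff.trans ?_ Finset.mem_filter.symm)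
  exact Iff.rfl

theorem precedingCount_le {f g : Fin n → ℕ∞} {x v : Fin n}
    (h : ∀ y, Precedes f y x → Precedes g y v) : precedingCount f x ≤ precedingCount g v := by
  classical
  exact Finset.card_le_card fun y hy => by
    simp only [Finset.mem_filter] at hy ⊢
    exact ⟨hy.1, h y hy.2⟩

theorem mem_kSmallest_of_precedes {k : ℕ} {f g : Fin n → ℕ∞} {x v : Fin n}
    (hv : v ∈ kSmallest k g) (h : ∀ y, Precedes f y x → Precedes g y v) : x ∈ kSmallest k f :=
  mem_kSmallest.2 ((precedingCount_le h).trans_lt (mem_kSmallest.1 hv))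

theorem Precedes.trans {f : Fin n → ℕ∞} {u v w : Fin n} (h : Precedes f u v)
    (h' : Precedes f v w) : Precedes f u w := by
  rcases h with h | ⟨h, hu⟩ <;> rcases h' with h' | ⟨h', hv⟩
  · exact Or.inl (h.trans h')
  · exact Or.inl (h'.symm ▸ h)
  · exact Or.inl (h ▸ h')
  · exact Or.inr ⟨h.trans h', hu.trans hv⟩

theorem precedingCount_lt {f : Fin n → ℕ∞} {u v : Fin n} (h : Precedes f u v) :
    precedingCount f u < precedingCount f v := by
  classical
  refine Finset.card_lt_card (Finset.ssubset_iff_subset_ne.2 ⟨fun y hy => ?_, fun he => ?_⟩)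
  · simp only [Finset.mem_filter] at hy ⊢
    exact ⟨hy.1, hy.2.trans h⟩
  · have : u ∈ Finset.univ.filter fun y => Precedes f y u := by rw [he]; simpa using h
    have := (Finset.mem_filter.1 this).2
    simp [Precedes] at this

theorem precedes_trichotomy (f : Fin n → ℕ∞) (u v : Fin n) :
    Precedes f u v ∨ u = v ∨ Precedes f v u := by
  rcases lt_trichotomy (f u) (f v) with h | h | h
  · exact Or.inl (Or.inl h)
  · rcases lt_trichotomy u v with h' | h' | h'
    · exact Or.inl (Or.inr ⟨h, h'⟩)
    · exact Or.inr (Or.inl h')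
    · exact Or.inr (Or.inr (Or.inr ⟨h.symm, h'⟩))
  · exact Or.inr (Or.inr (Or.inl h))

theorem precedingCount_injective (f : Fin n → ℕ∞) : Function.Injective (precedingCount f) := by
  intro u v h
  rcases precedes_trichotomy f u v with h' | h' | h'
  · exact absurd h (precedingCount_lt h').ne
  · exact h'
  · exact absurd h (precedingCount_lt h').ne'

theorem precedingCount_lt_card (f : Fin n → ℕ∞) (v : Fin n) : precedingCount f v < n := by
  classical
  have : (Finset.univ.filter fun u => Precedes f u v).card < (Finset.univ : Finset (Fin n)).card :=
    Finset.card_lt_card (Finset.filter_ssubset.2 ⟨v, Finset.mem_univ v, by simp [Precedes]⟩)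
  exact this.trans_eq (Finset.card_fin n)

/-- The ranks `precedingCount f` are a bijection onto the numbers below `n`. An excluded node has
rank at least `k`, so all ranks below `k` occur. -/
theorem le_card_kSmallest {k : ℕ} {f : Fin n → ℕ∞} {v : Fin n} (hv : v ∉ kSmallest k f) :
    k ≤ (kSmallest k f).card := by
  classical
  have hk : k ≤ precedingCount f v := not_lt.1 fun h => hv (mem_kSmallest.2 h)
  let r : Fin n → Fin n := fun u => ⟨precedingCount f u, precedingCount_lt_card f u⟩
  have hr : Function.Surjective r := Finite.surjective_of_injective fun u u' h =>
    precedingCount_injective f (Fin.mk.inj_iff.1 h)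
  have : Finset.range k ⊆ (kSmallest k f).image (precedingCount f) := by
    intro j hj
    rw [Finset.mem_range] at hj
    obtain ⟨u, hu⟩ := hr ⟨j, (hj.trans_le hk).trans (precedingCount_lt_card f v)⟩
    have hu := Fin.mk.inj_iff.1 hu
    exact Finset.mem_image.2 ⟨u, mem_kSmallest.2 (hu ▸ hj), hu⟩
  simpa using (Finset.card_le_card this).trans Finset.card_image_le

theorem mem_kSmallest_of_le {k : ℕ} {f g : Fin n → ℕ∞} (hle : ∀ u, f u ≤ g u) {v : Fin n}
    (hv : v ∈ kSmallest k f) (he : g v = f v) : v ∈ kSmallest k g := by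
  refine mem_kSmallest_of_precedes hv fun y hy => ?_
  rcases hy with hy | ⟨hy, hyv⟩
  · exact Or.inl ((hle y).trans_lt (he ▸ hy))
  · rcases (hle y).lt_or_eq with h | h
    · exact Or.inl (h.trans_eq (hy.trans he))
    · exact Or.inr ⟨h.trans (hy.trans he), hyv⟩

/-- Raising values outside the `k` smallest keeps those inside. A node outside is still preceded by
all of them, and there are at least `k`. -/
theorem kSmallest_congr {k : ℕ} {f g : Fin n → ℕ∞} (hle : ∀ u, f u ≤ g u)
    (he : ∀ u ∈ kSmallest k f, g u = f u) : kSmallest k g = kSmallest k f := by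
  classical
  refine Finset.Subset.antisymm (fun v hv => ?_)
    fun v hv => mem_kSmallest_of_le hle hv (he v hv)
  by_contra hv'
  have hsub : kSmallest k f ⊆ Finset.univ.filter fun u => Precedes g u v := by
    intro u hu
    refine Finset.mem_filter.2 ⟨Finset.mem_univ u, ?_⟩
    have huv : Precedes f u v := by
      rcases precedes_trichotomy f u v with h | h | h
      · exact h
      · exact absurd (h ▸ hu) hv'
      · exact absurd (mem_kSmallest.2 ((precedingCount_lt h).trans (mem_kSmallest.1 hu))) hv'
    rcases huv with h | ⟨h, h'⟩
    · exact Or.inl (he u hu ▸ h.trans_le (hle v))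
    · rcases (hle v).lt_or_eq with h2 | h2
      · exact Or.inl (by rw [he u hu, h]; exact h2)
      · exact Or.inr ⟨by rw [he u hu, h, h2], h'⟩
  exact absurd (mem_kSmallest.1 hv)
    (not_lt.2 ((le_card_kSmallest hv').trans (Finset.card_le_card hsub)))

/-- The row `f` restricted to its `k` smallest entries. -/
noncomputable def keepSmallest (k : ℕ) (f : Fin n → ℕ∞) (u : Fin n) : ℕ∞ :=
  open Classical in if u ∈ kSmallest k f then f u else ⊤

theorem keepSmallest_of_mem {k : ℕ} {f : Fin n → ℕ∞} {u : Fin n} (h : u ∈ kSmallest k f) :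
    keepSmallest k f u = f u := if_pos h

theorem le_keepSmallest (k : ℕ) (f : Fin n → ℕ∞) (u : Fin n) : f u ≤ keepSmallest k f u := by
  unfold keepSmallest
  split_ifs
  · exact le_rfl
  · exact le_top

theorem kSmallest_keepSmallest (k : ℕ) (f : Fin n → ℕ∞) :
    kSmallest k (keepSmallest k f) = kSmallest k f :=
  kSmallest_congr (le_keepSmallest k f) fun _ => keepSmallest_of_mem

theorem keepSmallest_congr {k : ℕ} {f g : Fin n → ℕ∞} (hle : ∀ u, f u ≤ g u)
    (he : ∀ u ∈ kSmallest k f, g u = f u) : keepSmallest k g = keepSmallest k f := by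
  funext u
  unfold keepSmallest
  rw [kSmallest_congr hle he]
  split_ifs with h
  · exact he u h
  · rfl

theorem keepSmallest_keepSmallest (k : ℕ) (f : Fin n → ℕ∞) :
    keepSmallest k (keepSmallest k f) = keepSmallest k f :=
  keepSmallest_congr (le_keepSmallest k f) fun _ => keepSmallest_of_mem

/-- The `k` smallest entries of a row as a list of `k` words; entries above `N` are left out. -/
noncomputable def pack (k N : ℕ) (f : Fin n → ℕ∞) (j : Fin k) : Option (Fin n × Fin (N + 1)) :=
  open Classical in
  if h : ∃ w : Fin n × Fin (N + 1), precedingCount f w.1 = j ∧ f w.1 = (w.2 : ℕ) then some h.choose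
  else none

/-- The row with the given entries. -/
noncomputable def unpack {k N : ℕ} (p : Fin k → Option (Fin n × Fin (N + 1))) (u : Fin n) : ℕ∞ :=
  ⨅ (j : Fin k) (x : Fin (N + 1)) (_ : p j = some (u, x)), ((x : ℕ) : ℕ∞)

/-- Dropping entries above `N` errs only upwards. This matters for partial powers, computed from
some of the rows, whose finite entries may exceed `N`. -/
theorem le_unpack_pack {k N : ℕ} (f : Fin n → ℕ∞) (u : Fin n) :
    keepSmallest k f u ≤ unpack (pack k N f) u := by
  refine le_iInf fun j => le_iInf fun x => le_iInf fun hx => ?_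
  unfold pack at hx
  split_ifs at hx with h
  have h1 := h.choose_spec
  rw [Option.some.inj hx] at h1
  rw [keepSmallest_of_mem (mem_kSmallest.2 (h1.1.trans_lt j.2)), h1.2]

theorem unpack_pack_of_le {k N : ℕ} {f : Fin n → ℕ∞} {u : Fin n} (hu : u ∈ kSmallest k f)
    (hN : f u ≤ N) : unpack (pack k N f) u = f u := by
  refine le_antisymm ?_ ((le_keepSmallest k f u).trans (le_unpack_pack f u))
  obtain ⟨x, hx⟩ := ENat.ne_top_iff_exists.1 (ne_top_of_le_ne_top (ENat.natCast_ne_top N) hN)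
  rw [← hx, Nat.cast_le] at hN
  let j : Fin k := ⟨precedingCount f u, mem_kSmallest.1 hu⟩
  have h : ∃ w : Fin n × Fin (N + 1), precedingCount f w.1 = j ∧ f w.1 = (w.2 : ℕ) :=
    ⟨(u, ⟨x, Nat.lt_succ_of_le hN⟩), rfl, hx.symm⟩
  have h1 : h.choose.1 = u := precedingCount_injective f h.choose_spec.1
  have h2 : f u = (h.choose.2 : ℕ) := h1 ▸ h.choose_spec.2
  refine (iInf_le_of_le j (iInf_le_of_le h.choose.2 (iInf_le_of_le ?_ le_rfl))).trans_eq h2.symm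
  unfold pack
  rw [dif_pos h]
  exact congrArg some (Prod.ext h1 rfl)

theorem unpack_pack {k N : ℕ} {f : Fin n → ℕ∞} (hN : ∀ u, f u ≠ ⊤ → f u ≤ N) :
    unpack (pack k N f) = keepSmallest k f := by
  funext u
  refine le_antisymm ?_ (le_unpack_pack f u)
  by_cases h : u ∈ kSmallest k f ∧ f u ≠ ⊤
  · rw [unpack_pack_of_le h.1 (hN u h.2)]
    exact le_keepSmallest k f u
  · refine le_top.trans_eq (Eq.symm ?_)
    unfold keepSmallest
    split_ifs with h1
    · exact not_not.1 fun h2 => h ⟨h1, h2⟩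
    · rfl

end KSmallest

/-! ### Min-plus powers and their dependence on rows -/

section MinPlus

variable {n : ℕ}

/-- The powers of a matrix in the min-plus semiring. -/
noncomputable def minPlusPow (W : Fin n → Fin n → ℕ∞) : ℕ → Fin n → Fin n → ℕ∞
  | 0, u, v => if u = v then 0 else ⊤
  | m + 1, u, v => ⨅ x, W u x + minPlusPow W m x v

theorem exists_minPlusPow_succ_eq (W : Fin n → Fin n → ℕ∞) (m : ℕ) (u v : Fin n) :
    ∃ x, minPlusPow W (m + 1) u v = W u x + minPlusPow W m x v := by
  have : Nonempty (Fin n) := ⟨u⟩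
  obtain ⟨x, hx⟩ := exists_eq_ciInf_of_finite (f := fun x => W u x + minPlusPow W m x v)
  exact ⟨x, hx.symm⟩

theorem minPlusPow_succ_le (W : Fin n → Fin n → ℕ∞) (m : ℕ) (u x v : Fin n) :
    minPlusPow W (m + 1) u v ≤ W u x + minPlusPow W m x v := iInf_le _ x

theorem minPlusPow_mono {W W' : Fin n → Fin n → ℕ∞} (h : ∀ u v, W u v ≤ W' u v) (m : ℕ)
    (u v : Fin n) : minPlusPow W m u v ≤ minPlusPow W' m u v := by
  induction m generalizing u with
  | zero => exact le_rfl
  | succ m ih => exact iInf_mono fun x => add_le_add (h u x) (ih x)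

theorem minPlusPow_one (W : Fin n → Fin n → ℕ∞) : minPlusPow W 1 = W := by
  funext u v
  refine le_antisymm ((minPlusPow_succ_le W 0 u v v).trans_eq (by simp [minPlusPow])) ?_
  obtain ⟨x, hx⟩ := exists_minPlusPow_succ_eq W 0 u v
  rw [hx, minPlusPow]
  split_ifs with h <;> simp [h]

theorem minPlusPow_add (W : Fin n → Fin n → ℕ∞) (a b : ℕ) (u v : Fin n) :
    minPlusPow W (a + b) u v = ⨅ x, minPlusPow W a u x + minPlusPow W b x v := by
  induction a generalizing u with
  | zero =>
    rw [zero_add]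
    refine le_antisymm (le_iInf fun x => ?_) (iInf_le_of_le u (by simp [minPlusPow]))
    simp only [minPlusPow]
    split_ifs with h <;> simp [h]
  | succ a ih =>
    rw [Nat.succ_add]
    simp only [minPlusPow, ih, ENat.add_iInf, ENat.iInf_add, add_assoc]
    exact iInf_comm

theorem minPlusPow_mul (W : Fin n → Fin n → ℕ∞) (a b : ℕ) :
    minPlusPow W (a * b) = minPlusPow (minPlusPow W a) b := by
  induction b with
  | zero => rfl
  | succ b ih =>
    funext u v
    rw [Nat.mul_succ, add_comm, minPlusPow_add, ih]
    rfl

/-- Exactly the diagonal entries vanish. -/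
def ZeroIffEq (W : Fin n → Fin n → ℕ∞) : Prop := ∀ u v, W u v = 0 ↔ u = v

theorem ZeroIffEq.minPlusPow {W : Fin n → Fin n → ℕ∞} (hW : ZeroIffEq W) (m : ℕ) :
    ZeroIffEq (minPlusPow W m) := by
  induction m with
  | zero => intro u v; simp [_root_.minPlusPow]
  | succ m ih =>
    intro u v
    constructor
    · intro h
      obtain ⟨x, hx⟩ := exists_minPlusPow_succ_eq W m u v
      rw [hx, add_eq_zero, hW, ih] at h
      exact h.1.trans h.2
    · rintro rfl
      refine le_antisymm ((minPlusPow_succ_le W m u u u).trans_eq ?_) zero_le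
      rw [(hW u u).2 rfl, (ih u u).2 rfl, add_zero]

/-- The `k` smallest entries of each row of a power depend only on the `k` smallest entries of
each row of the matrix. -/
theorem minPlusPow_keepSmallest {W : Fin n → Fin n → ℕ∞} (hW : ZeroIffEq W) (k m : ℕ)
    (u v : Fin n) (hv : v ∈ kSmallest k (minPlusPow W m u)) :
    minPlusPow (fun x => keepSmallest k (W x)) m u v = minPlusPow W m u v := by
  refine le_antisymm ?_ (minPlusPow_mono (fun x => le_keepSmallest k (W x)) m u v)
  induction m generalizing u with
  | zero => exact le_rfl
  | succ m ih =>
    by_cases htop : minPlusPow W (m + 1) u v = ⊤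
    · rw [htop]; exact le_top
    obtain ⟨x, hx⟩ := exists_minPlusPow_succ_eq W m u v
    rw [hx, ENat.add_eq_top, not_or] at htop
    -- Because of the zero diagonal, whatever precedes the first step `x` in row `u` of `W` is at
    -- most as far in the power. If `x ≠ v`, the rest of the way to `v` has positive length, so it
    -- strictly precedes `v`; if `x = v`, the tie-breaking is the same.
    have h1 : x ∈ kSmallest k (W u) := by
      refine mem_kSmallest_of_precedes hv fun y hy => ?_
      have hyu : minPlusPow W (m + 1) u y ≤ W u y :=
        (minPlusPow_succ_le W m u y y).trans_eq
          (by rw [(hW.minPlusPow m y y).2 rfl, add_zero])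
      by_cases hxv : x = v
      · subst hxv
        rw [(hW.minPlusPow m x x).2 rfl, add_zero] at hx
        rcases hy with hy | ⟨hy, hyx⟩
        · exact Or.inl (hyu.trans_lt (hy.trans_eq hx.symm))
        · rcases (hyu.trans_eq (hy.trans hx.symm)).lt_or_eq with h | h
          · exact Or.inl h
          · exact Or.inr ⟨h, hyx⟩
      · have hle : W u y ≤ W u x := hy.elim le_of_lt fun h => h.1.le
        refine Or.inl ((hyu.trans hle).trans_lt ?_)
        rw [hx]
        refine lt_of_le_of_ne le_self_add fun h => hxv ((hW.minPlusPow m x v).1 ?_)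
        exact WithTop.add_left_cancel htop.1 (h.symm.trans (add_zero _).symm)
    -- Prefixing the step from `u` to `x` adds the same finite amount to all candidates, so whatever
    -- precedes `v` from `x` precedes it from `u`.
    have h2 : v ∈ kSmallest k (minPlusPow W m x) := by
      refine mem_kSmallest_of_precedes hv fun y hy => ?_
      have hyu := minPlusPow_succ_le W m u x y
      rcases hy with hy | ⟨hy, hyv⟩
      · refine Or.inl (hyu.trans_lt ?_)
        rw [hx]
        exact (ENat.add_lt_add_iff_left htop.1).2 hy
      · rw [hy, ← hx] at hyu
        rcases hyu.lt_or_eq with h | h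
        · exact Or.inl h
        · exact Or.inr ⟨h, hyv⟩
    rw [hx]
    refine (minPlusPow_succ_le _ m u x v).trans (add_le_add ?_ (ih x h2))
    rw [keepSmallest_of_mem h1]

theorem keepSmallest_minPlusPow_keepSmallest {W : Fin n → Fin n → ℕ∞} (hW : ZeroIffEq W)
    (k m : ℕ) (u : Fin n) :
    keepSmallest k (minPlusPow (fun x => keepSmallest k (W x)) m u) =
      keepSmallest k (minPlusPow W m u) :=
  keepSmallest_congr (minPlusPow_mono (fun x => le_keepSmallest k (W x)) m u)
    (minPlusPow_keepSmallest hW k m u)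

/-- The matrix with only the rows in `S` kept. -/
noncomputable def restrictRows (W : Fin n → Fin n → ℕ∞) (S : Finset (Fin n)) (u v : Fin n) : ℕ∞ :=
  if u ∈ S then W u v else ⊤

theorem le_restrictRows (W : Fin n → Fin n → ℕ∞) (S : Finset (Fin n)) (u v : Fin n) :
    W u v ≤ restrictRows W S u v := by
  unfold restrictRows
  split_ifs
  · exact le_rfl
  · exact le_top

/-- An entry of the `m`-th power depends on at most `m` rows of the matrix. -/
theorem exists_rows_minPlusPow (W : Fin n → Fin n → ℕ∞) (m : ℕ) (u v : Fin n) :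
    ∃ S : Finset (Fin n), S.card ≤ m ∧ (0 < m → u ∈ S) ∧ ∀ S', S ⊆ S' →
      minPlusPow (restrictRows W S') m u v = minPlusPow W m u v := by
  induction m generalizing u with
  | zero => exact ⟨∅, by simp, by simp, fun _ _ => rfl⟩
  | succ m ih =>
    obtain ⟨x, hx⟩ := exists_minPlusPow_succ_eq W m u v
    obtain ⟨S, hS, -, hS'⟩ := ih x
    refine ⟨insert u S, (Finset.card_insert_le u S).trans (Nat.succ_le_succ hS),
      fun _ => Finset.mem_insert_self u S, fun S' h => ?_⟩
    refine le_antisymm ?_ (minPlusPow_mono (le_restrictRows W S') _ u v)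
    rw [hx, ← hS' S' ((Finset.subset_insert u S).trans h)]
    refine (minPlusPow_succ_le _ m u x v).trans_eq ?_
    rw [restrictRows, if_pos (h (Finset.mem_insert_self u S))]

end MinPlus

/-! ### Balanced covers -/

/-- The binomial is at most `(h * m) ^ h / h!`, and `h ^ h / h! ≤ exp h ≤ 3 ^ h`. -/
theorem choose_mul_le_pow (h m : ℕ) : (h * m).choose h ≤ (3 * m) ^ h := by
  have h1 : ((h * m).choose h : ℝ) ≤ ((h * m : ℕ) : ℝ) ^ h / (h.factorial : ℝ) :=
    Nat.choose_le_pow_div h (h * m)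
  have h2 : (h : ℝ) ^ h / (h.factorial : ℝ) ≤ 3 ^ h := by
    refine (Real.pow_div_factorial_le_exp _ (Nat.cast_nonneg h) h).trans ?_
    rw [← mul_one (h : ℝ), Real.exp_nat_mul]
    exact pow_le_pow_left₀ (Real.exp_pos 1).le (Real.exp_one_lt_d9.le.trans (by norm_num)) h
  have h3 : ((h * m).choose h : ℝ) ≤ (3 * m : ℝ) ^ h := by
    refine h1.trans ?_
    rw [Nat.cast_mul, mul_pow, mul_pow, mul_div_right_comm]
    exact mul_le_mul_of_nonneg_right h2 (by positivity)
  exact_mod_cast h3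

/-- Removing `b` leaves an `(h - 1)`-subset of the other `p - 1` points, and `p * (p - 1).choose (h
- 1) = h * p.choose h`. -/
theorem card_powersetCard_filter_mem_le {p h : ℕ} (hh : 0 < h) (b : Fin p) :
    ((Finset.powersetCard h Finset.univ).filter fun s : Finset (Fin p) => b ∈ s).card * p ≤
      h * p.choose h := by
  obtain ⟨h, rfl⟩ := Nat.exists_eq_succ_of_ne_zero hh.ne'
  obtain ⟨p, rfl⟩ := Nat.exists_eq_succ_of_ne_zero b.pos.ne'
  have hsub : ((Finset.powersetCard (h + 1) Finset.univ).filter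
      fun s : Finset (Fin (p + 1)) => b ∈ s) ⊆
        (Finset.powersetCard h (Finset.univ.erase b)).image (insert b) := by
    intro s hs
    rw [Finset.mem_filter, Finset.mem_powersetCard] at hs
    refine Finset.mem_image.2 ⟨s.erase b, ?_, Finset.insert_erase hs.2⟩
    rw [Finset.mem_powersetCard, Finset.card_erase_of_mem hs.2, hs.1.2]
    exact ⟨Finset.erase_subset_erase b (Finset.subset_univ s), rfl⟩
  have hc := (Finset.card_le_card hsub).trans Finset.card_image_le
  rw [Finset.card_powersetCard, Finset.card_erase_of_mem (Finset.mem_univ b), Finset.card_univ,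
    Fintype.card_fin, Nat.succ_sub_one] at hc
  calc _ ≤ p.choose h * (p + 1) := Nat.mul_le_mul_right _ hc
    _ = _ := by rw [mul_comm, Nat.add_one_mul_choose_eq, mul_comm]

/-- A balanced family of `n` subsets of the node set that covers all sets of at most `h` nodes. -/
theorem exists_balanced_cover {n h m : ℕ} (hh : 0 < h) (hm : 0 < m) (hn : (3 * m) ^ h ≤ n) :
    ∃ U : Fin n → Finset (Fin n),
      (∀ S : Finset (Fin n), S.card ≤ h → ∃ w, S ⊆ U w) ∧
      (∀ v, m * (Finset.univ.filter fun w => v ∈ U w).card ≤ n) ∧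
      ∀ w, m * (U w).card ≤ 2 * n := by
  classical
  have hp : 0 < h * m := Nat.mul_pos hh hm
  have hpn : h * m ≤ n := by
    refine le_trans ?_ hn
    rw [mul_pow]
    exact Nat.mul_le_mul (Nat.lt_pow_self (by norm_num)).le (Nat.le_self_pow hh.ne' m)
  have hq : n < h * m * (n / (h * m) + 1) := Nat.lt_mul_div_succ n hp
  have hq' : h * m * (n / (h * m) + 1) ≤ 2 * n := by
    have := Nat.mul_div_le n (h * m)
    rw [mul_add]; omega
  generalize n / (h * m) + 1 = q at hq hq'
  have hq0 : 0 < q := Nat.pos_of_ne_zero (by rintro rfl; simp at hq)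
  -- Consecutive blocks of `q` nodes; rounding `q` up costs at most a factor 2, as there are at most
  -- `n` blocks.
  let block : Fin n → Fin (h * m) := fun v => ⟨v / q, Nat.div_lt_of_lt_mul (by
    rw [mul_comm q]; exact v.2.trans hq)⟩
  have hblock : ∀ b, (Finset.univ.filter fun v => block v = b).card ≤ q := by
    intro b
    have : ((Finset.univ.filter fun v => block v = b).map Fin.valEmbedding) ⊆
        Finset.Ico (b * q : ℕ) (b * q + q) := by
      intro x hx
      obtain ⟨v, hv, rfl⟩ := Finset.mem_map.1 hx
      have hv := Fin.ext_iff.1 (Finset.mem_filter.1 hv).2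
      simp only [block] at hv
      rw [Nat.div_eq_iff hq0] at hv
      simp only [Fin.valEmbedding_apply, Finset.mem_Ico]
      omega
    simpa using Finset.card_le_card this
  have hcard : Fintype.card {s // s ∈ Finset.powersetCard h (Finset.univ : Finset (Fin (h * m)))} ≤
      Fintype.card (Fin n) := by
    rw [Fintype.card_coe, Finset.card_powersetCard, Finset.card_univ, Fintype.card_fin,
      Fintype.card_fin]
    exact (choose_mul_le_pow h m).trans hn
  obtain ⟨e⟩ := Function.Embedding.nonempty_of_card_le hcard
  -- Nodes to which no combination of blocks is assigned get the empty set and stay idle.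
  let comb : Fin n → Finset (Fin (h * m)) := fun w =>
    if hx : ∃ s, e s = w then hx.choose.1 else ∅
  have hcomb : ∀ s, comb (e s) = s.1 := by
    intro s
    have hx : ∃ s', e s' = e s := ⟨s, rfl⟩
    simp only [comb]
    rw [dif_pos hx, e.injective hx.choose_spec]
  have hcomb' : ∀ w, comb w ≠ ∅ → ∃ s, e s = w := by
    intro w hw
    by_contra hx
    exact hw (by simp only [comb]; rw [dif_neg hx])
  have hsize : ∀ w, (comb w).card ≤ h := by
    intro w
    by_cases hw : comb w = ∅
    · simp [hw]
    · obtain ⟨s, rfl⟩ := hcomb' w hw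
      rw [hcomb]
      exact (Finset.mem_powersetCard.1 s.2).2.le
  refine ⟨fun w => Finset.univ.filter fun v => block v ∈ comb w, ?_, ?_, ?_⟩
  · intro S hS
    obtain ⟨t, ht, htc⟩ := Finset.exists_superset_card_eq (s := S.image block) (n := h)
      (Finset.card_image_le.trans hS) (by
        rw [Fintype.card_fin]; exact Nat.le_mul_of_pos_right h hm)
    refine ⟨e ⟨t, Finset.mem_powersetCard.2 ⟨Finset.subset_univ t, htc⟩⟩, fun v hv => ?_⟩
    rw [Finset.mem_filter, hcomb]
    exact ⟨Finset.mem_univ v, ht (Finset.mem_image_of_mem block hv)⟩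
  · intro v
    have h1 : (Finset.univ.filter fun w => block v ∈ comb w).card ≤
        ((Finset.powersetCard h Finset.univ).filter fun s => block v ∈ s).card := by
      refine Finset.card_le_card_of_injOn comb ?_ ?_
      · intro w hw
        have hw := (Finset.mem_filter.1 hw).2
        obtain ⟨s, rfl⟩ := hcomb' w (Finset.ne_empty_of_mem hw)
        rw [hcomb] at hw ⊢
        exact Finset.mem_filter.2 ⟨s.2, hw⟩
      · intro w hw w' hw' hww
        obtain ⟨s, rfl⟩ := hcomb' w (Finset.ne_empty_of_mem (Finset.mem_filter.1 hw).2)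
        obtain ⟨s', rfl⟩ := hcomb' w' (Finset.ne_empty_of_mem (Finset.mem_filter.1 hw').2)
        rw [hcomb, hcomb] at hww
        rw [Subtype.ext hww]
    have h2 := card_powersetCard_filter_mem_le hh (block v)
    -- A block lies in the fraction `h / (h * m) = 1 / m` of all combinations.
    have h3 : m * (Finset.univ.filter fun w => block v ∈ comb w).card ≤ (h * m).choose h := by
      refine Nat.le_of_mul_le_mul_left ?_ hh
      calc _ = (Finset.univ.filter fun w => block v ∈ comb w).card * (h * m) := by ring
        _ ≤ _ := (Nat.mul_le_mul_right _ h1).trans h2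
    simpa using h3.trans ((choose_mul_le_pow h m).trans hn)
  · intro w
    have h1 : (Finset.univ.filter fun v => block v ∈ comb w).card ≤ q * (comb w).card := by
      refine Finset.card_le_mul_card_image_of_maps_to (f := block) ?_ q ?_
      · intro v hv; exact (Finset.mem_filter.1 hv).2
      · intro b _
        refine (Finset.card_le_card ?_).trans (hblock b)
        exact Finset.filter_subset_filter _ (Finset.subset_univ _)
    calc _ ≤ m * (q * h) := Nat.mul_le_mul_left m (h1.trans (Nat.mul_le_mul_left q (hsize w)))
      _ = h * m * q := by ring
      _ ≤ _ := hq'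

/-! ### Hop distances as min-plus powers, and their size -/

namespace WDigraph

variable {n : ℕ}

/-- The matrix of the one-hop distances. -/
noncomputable def hopMatrix (G : WDigraph n) (u v : Fin n) : ℕ∞ :=
  if u = v then 0 else G.weight u v

theorem hopMatrix_le (G : WDigraph n) (u v : Fin n) : G.hopMatrix u v ≤ G.weight u v := by
  unfold hopMatrix
  split_ifs
  · exact zero_le
  · exact le_rfl

theorem zeroIffEq_hopMatrix (G : WDigraph n) : ZeroIffEq G.hopMatrix := by
  intro u v
  unfold hopMatrix
  split_ifs with h
  · simp [h]
  · simp [h, (G.pos u v).ne']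

theorem minPlusPow_hopMatrix_le {G : WDigraph n} {u v : Fin n} {t l q : ℕ}
    (h : G.HasPath u v t l) (hq : t ≤ q) : minPlusPow G.hopMatrix q u v ≤ l := by
  induction h generalizing q with
  | nil u => rw [(G.zeroIffEq_hopMatrix.minPlusPow q u u).2 rfl]; exact zero_le
  | @cons u x v w t l hw _ ih =>
    obtain ⟨q, rfl⟩ := Nat.exists_eq_succ_of_ne_zero (Nat.pos_of_ne_zero (by omega) : 0 < q).ne'
    refine (minPlusPow_succ_le _ q u x v).trans ?_
    rw [Nat.cast_add]
    exact add_le_add (hw ▸ G.hopMatrix_le u x) (ih (Nat.le_of_succ_le_succ hq))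

theorem exists_hasPath_of_minPlusPow {G : WDigraph n} {u v : Fin n} {q l : ℕ}
    (h : minPlusPow G.hopMatrix q u v = l) : ∃ t ≤ q, G.HasPath u v t l := by
  induction q generalizing u l with
  | zero =>
    simp only [minPlusPow] at h
    split_ifs at h with huv
    · subst huv
      have : l = 0 := by exact_mod_cast h.symm
      subst this
      exact ⟨0, le_rfl, .nil u⟩
    · exact absurd h.symm (ENat.natCast_ne_top l)
  | succ q ih =>
    obtain ⟨x, hx⟩ := exists_minPlusPow_succ_eq G.hopMatrix q u v
    rw [h] at hx
    have htop := ENat.natCast_ne_top l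
    rw [hx, Ne, ENat.add_eq_top, not_or] at htop
    obtain ⟨a, ha⟩ := ENat.ne_top_iff_exists.1 htop.1
    obtain ⟨b, hb⟩ := ENat.ne_top_iff_exists.1 htop.2
    obtain ⟨t, ht, hp⟩ := ih hb.symm
    rw [← ha, ← hb, ← Nat.cast_add, Nat.cast_inj] at hx
    subst hx
    unfold hopMatrix at ha
    split_ifs at ha with hux
    · subst hux
      have : a = 0 := by exact_mod_cast ha
      subst this
      exact ⟨t, ht.trans (Nat.le_succ q), by rwa [zero_add]⟩
    · exact ⟨t + 1, Nat.succ_le_succ ht, .cons ha.symm hp⟩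

theorem hopDist_eq_minPlusPow (G : WDigraph n) (q : ℕ) :
    G.hopDist q = minPlusPow G.hopMatrix q := by
  funext u v
  refine le_antisymm ?_ (le_sInf ?_)
  · by_cases h : minPlusPow G.hopMatrix q u v = ⊤
    · rw [h]; exact le_top
    · obtain ⟨l, hl⟩ := ENat.ne_top_iff_exists.1 h
      obtain ⟨t, ht, hp⟩ := exists_hasPath_of_minPlusPow hl.symm
      exact sInf_le ⟨t, l, ht, hp, hl.symm⟩
  · rintro _ ⟨t, l, ht, hp, rfl⟩
    exact minPlusPow_hopMatrix_le hp ht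

/-- A path together with the list of its nodes. -/
inductive HasPathVia (G : WDigraph n) : Fin n → Fin n → List (Fin n) → ℕ → Prop
  | nil (u : Fin n) : HasPathVia G u u [u] 0
  | cons {u x v : Fin n} {p : List (Fin n)} {w l : ℕ} :
      G.weight u x = (w : ℕ∞) → HasPathVia G x v p l → HasPathVia G u v (u :: p) (w + l)

theorem HasPathVia.hasPath {G : WDigraph n} {u v : Fin n} {p : List (Fin n)} {l : ℕ}
    (h : G.HasPathVia u v p l) : ∃ t, t + 1 = p.length ∧ G.HasPath u v t l := by
  induction h with
  | nil u => exact ⟨0, rfl, .nil u⟩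
  | cons hw _ ih =>
    obtain ⟨t, ht, hp⟩ := ih
    exact ⟨t + 1, by simp [ht], .cons hw hp⟩

theorem HasPathVia.exists_suffix {G : WDigraph n} {u v y : Fin n} {p : List (Fin n)} {l : ℕ}
    (h : G.HasPathVia u v p l) (hy : y ∈ p) :
    ∃ p' l', p' <:+ p ∧ l' ≤ l ∧ G.HasPathVia y v p' l' := by
  induction h with
  | nil u =>
    rw [List.mem_singleton] at hy
    subst hy
    exact ⟨_, _, List.suffix_rfl, le_rfl, .nil y⟩
  | @cons u x v p w l hw hp ih =>
    rcases List.mem_cons.1 hy with rfl | hy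
    · exact ⟨_, _, List.suffix_rfl, le_rfl, .cons hw hp⟩
    · obtain ⟨p', l', h1, h2, h3⟩ := ih hy
      exact ⟨p', l', h1.trans (List.suffix_cons u p), h2.trans (Nat.le_add_left l w), h3⟩

/-- Loop erasure: if the new first node already occurs, the suffix starting there is used, which
increases neither the number of hops nor the length. -/
theorem HasPath.exists_nodup {G : WDigraph n} {u v : Fin n} {t l : ℕ} (h : G.HasPath u v t l) :
    ∃ p l', p.Nodup ∧ p.length ≤ t + 1 ∧ l' ≤ l ∧ G.HasPathVia u v p l' := by
  induction h with
  | nil u => exact ⟨[u], 0, by simp, by simp, le_rfl, .nil u⟩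
  | @cons u x v w t l hw _ ih =>
    obtain ⟨p, l', h1, h2, h3, h4⟩ := ih
    by_cases hu : u ∈ p
    · obtain ⟨p', l'', h5, h6, h7⟩ := h4.exists_suffix hu
      exact ⟨p', l'', h1.sublist h5.sublist, h5.length_le.trans (by omega), by omega, h7⟩
    · exact ⟨u :: p, w + l', List.nodup_cons.2 ⟨hu, h1⟩, by simpa using h2, by omega, .cons hw h4⟩

theorem HasPath.length_le {G : WDigraph n} {N : ℕ} (hG : G.WeightsLE N) {u v : Fin n} {t l : ℕ}
    (h : G.HasPath u v t l) : l ≤ t * N := by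
  induction h with
  | nil u => simp
  | @cons u x v w t l hw _ ih =>
    have : w ≤ N := by
      have := hG u x (by rw [hw]; exact ENat.natCast_ne_top w)
      rw [hw] at this
      exact_mod_cast this
    rw [add_mul, one_mul]
    omega

/-- A loop-free path has fewer than `n` hops. The bound does not depend on `q`, so one message size
serves all iterations. -/
theorem minPlusPow_hopMatrix_le_of_ne_top {G : WDigraph n} {N : ℕ} (hG : G.WeightsLE N) {q : ℕ} {u v : Fin n}
    (h : minPlusPow G.hopMatrix q u v ≠ ⊤) : minPlusPow G.hopMatrix q u v ≤ (n * N : ℕ) := by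
  obtain ⟨l, hl⟩ := ENat.ne_top_iff_exists.1 h
  obtain ⟨t, ht, hp⟩ := exists_hasPath_of_minPlusPow hl.symm
  obtain ⟨p, l', h1, h2, h3, h4⟩ := hp.exists_nodup
  obtain ⟨t', ht', hp'⟩ := h4.hasPath
  refine (minPlusPow_hopMatrix_le hp' (by omega)).trans (Nat.cast_le.2 ((hp'.length_le hG).trans ?_))
  have := h1.length_le_card
  rw [Fintype.card_fin] at this
  exact Nat.mul_le_mul_right N (by omega)

theorem dist_le_hopDist (G : WDigraph n) (q : ℕ) (u v : Fin n) : G.dist u v ≤ G.hopDist q u v :=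
  sInf_le_sInf fun _ ⟨t, l, _, h⟩ => ⟨t, l, h⟩

theorem weightsLE_union {G H : WDigraph n} {N : ℕ} (hG : G.WeightsLE N) (hH : H.WeightsLE N) :
    (G.union H).WeightsLE N := by
  intro u v h
  simp only [union] at h ⊢
  rcases min_choice (G.weight u v) (H.weight u v) with he | he
  · rw [he] at h ⊢; exact hG u v h
  · rw [he] at h ⊢; exact hH u v h

/-- With a hopset, the nearest nodes and their distances are those for a bounded number of hops. -/
theorem IsKNearestHopset.nearestDistances_eq {k β : ℕ} {G H : WDigraph n}
    (h : IsKNearestHopset k β G H) (v : Fin n) :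
    G.nearestDistances k v = (G.union H).nearestHopDistances k β v := by
  classical
  have hle : ∀ u, G.dist v u ≤ (G.union H).hopDist β v u := fun u =>
    (h.dist_eq v u).trans_le ((G.union H).dist_le_hopDist β v u)
  have he : ∀ u ∈ kSmallest k (G.dist v), (G.union H).hopDist β v u = G.dist v u := by
    intro u hu
    refine le_antisymm ?_ (hle u)
    by_cases htop : G.dist v u = ⊤
    · rw [htop]; exact le_top
    · obtain ⟨d, hd⟩ := ENat.ne_top_iff_exists.1 htop
      obtain ⟨t, ht, hp⟩ := h.path v u hu d hd.symm
      exact sInf_le ⟨t, d, ht, hp, hd.symm⟩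
  unfold nearestDistances nearestHopDistances kNearest kNearestHop
  rw [kSmallest_congr hle he]
  exact Finset.image_congr fun u hu => by rw [he u hu]

end WDigraph

/-! ### One min-plus power in a bounded number of rounds -/

theorem exists_code {α : Type} [Fintype α] [Nonempty α] {B : ℕ} (h : Fintype.card α ≤ 2 ^ B) :
    ∃ (enc : α → Fin B → Bool) (dec : (Fin B → Bool) → α), ∀ a, dec (enc a) = a := by
  obtain ⟨e⟩ := Function.Embedding.nonempty_of_card_le (α := α) (β := Fin B → Bool) (by simpa)
  exact ⟨e, Function.invFun e, Function.leftInverse_invFun e.injective⟩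

/-- A word is an identifier with a distance up to `n ^ (c + 1)`, or nothing. With `X = 2 ^ (Nat.log
2 n + 1) > n` the count `n ^ (c + 2) + n + 1` is at most `2 * X ^ (c + 2) ≤ X ^ (c + 3)`. -/
theorem card_word_le (c n : ℕ) :
    Fintype.card (Option (Fin n × Fin (n * n ^ c + 1))) ≤ 2 ^ messageBits (c + 3) n := by
  have hn : n + 1 ≤ 2 ^ (Nat.log 2 n + 1) := Nat.lt_pow_succ_log_self (by norm_num) n
  rw [messageBits, mul_comm (c + 3), pow_mul]
  have h2 : 2 ≤ 2 ^ (Nat.log 2 n + 1) := Nat.le_self_pow (by omega) 2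
  generalize 2 ^ (Nat.log 2 n + 1) = X at hn h2
  simp only [Fintype.card_option, Fintype.card_prod, Fintype.card_fin]
  have h1 : n ^ (c + 2) ≤ X ^ (c + 2) := Nat.pow_le_pow_left (by omega) _
  have h3 : X ≤ X ^ (c + 2) := Nat.le_self_pow (by omega) X
  calc n * (n * n ^ c + 1) + 1 = n ^ (c + 2) + (n + 1) := by ring
    _ ≤ X ^ (c + 2) * 2 := by omega
    _ ≤ X ^ (c + 2) * X := Nat.mul_le_mul_left _ h2
    _ = X ^ (c + 3) := by ring

section Step

variable {n B N k : ℕ} {ι : Type} {W : ι → Fin n → Fin n → ℕ∞}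

theorem unpack_pack_keepSmallest {f : Fin n → ℕ∞} (hf : ∀ u, f u ≠ ⊤ → f u ≤ N) :
    unpack (pack k N (keepSmallest k f)) = keepSmallest k f := by
  rw [unpack_pack, keepSmallest_keepSmallest]
  intro u hu
  by_cases h : u ∈ kSmallest k f
  · rw [keepSmallest_of_mem h] at hu ⊢
    exact hf u hu
  · exact absurd (if_neg h) hu

/-- A min-plus power of matrices with `k` relevant entries per row, by broadcasting all of them. -/
theorem Reach.minPlusPow_broadcast (h : ℕ)
    (hB : Fintype.card (Option (Fin n × Fin (N + 1))) ≤ 2 ^ B) (hW : ∀ i, ZeroIffEq (W i))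
    (hN : ∀ i u v, W i u v ≠ ⊤ → W i u v ≤ N) :
    Reach B (fun i v => keepSmallest k (minPlusPow (W i) h v)) k (Fin n → ℕ∞)
      (fun i v => keepSmallest k (W i v)) := by
  obtain ⟨enc, dec, hdec⟩ := exists_code hB
  refine (Reach.rounds k _ fun t _ s _ => enc (pack k N s t)).then_compute
    (fun v s => keepSmallest k (minPlusPow (fun u => unpack fun t => dec (s.2 t u)) h v))
    fun i v => ?_
  simp only [hdec]
  rw [← keepSmallest_minPlusPow_keepSmallest (hW i)]
  congr 2
  funext u
  exact (unpack_pack_keepSmallest (hN i u)).symm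

/-- The best values that a cover by sets of rows yields have the right `k` smallest entries. -/
theorem keepSmallest_iInf_cover {W : Fin n → Fin n → ℕ∞} {h : ℕ} (hh : 0 < h) (hW : ZeroIffEq W)
    (hN : ∀ u v, minPlusPow W h u v ≠ ⊤ → minPlusPow W h u v ≤ N) {U : Fin n → Finset (Fin n)}
    (hU : ∀ S : Finset (Fin n), S.card ≤ h → ∃ w, S ⊆ U w) (v : Fin n) :
    keepSmallest k (fun x => ⨅ (w : Fin n) (_ : v ∈ U w), unpack (pack k N
      (minPlusPow (restrictRows (fun u => keepSmallest k (W u)) (U w)) h v)) x) =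
      keepSmallest k (minPlusPow W h v) := by
  have hle : ∀ w x, minPlusPow W h v x ≤
      minPlusPow (restrictRows (fun u => keepSmallest k (W u)) (U w)) h v x := fun w x =>
    minPlusPow_mono (fun a b => (le_keepSmallest k (W a) b).trans
      (le_restrictRows (fun u => keepSmallest k (W u)) (U w) a b)) h v x
  have hle' : ∀ x, minPlusPow W h v x ≤ ⨅ (w : Fin n) (_ : v ∈ U w), unpack (pack k N
      (minPlusPow (restrictRows (fun u => keepSmallest k (W u)) (U w)) h v)) x := fun x =>
    le_iInf fun w => le_iInf fun _ =>
      (hle w x).trans ((le_keepSmallest k _ x).trans (le_unpack_pack _ x))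
  refine keepSmallest_congr hle' fun x hx => le_antisymm ?_ (hle' x)
  by_cases htop : minPlusPow W h v x = ⊤
  · rw [htop]; exact le_top
  obtain ⟨S, hS, hvS, hS'⟩ := exists_rows_minPlusPow (fun u => keepSmallest k (W u)) h v x
  obtain ⟨w, hw⟩ := hU S hS
  have he : minPlusPow (restrictRows (fun u => keepSmallest k (W u)) (U w)) h v x =
      minPlusPow W h v x := (hS' _ hw).trans (minPlusPow_keepSmallest hW k h v x hx)
  -- As `h` is positive, the rows used include that of `v`, so `w` is among the nodes that answer
  -- `v`. The partial power at `w` dominates the true one and is right at `x`, so `x` is among its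
  -- `k` smallest entries and is sent.
  refine (iInf_le_of_le w (iInf_le_of_le (hw (hvS hh)) le_rfl)).trans_eq ?_
  rw [unpack_pack_of_le (mem_kSmallest_of_le (hle w) hx he) (he.trans_le (hN v x htop)), he]

/-- A min-plus power of matrices with `k` relevant entries per row, by a balanced cover of the sets
of at most `h` rows: node `w` takes care of the rows in `U w`. -/
theorem Reach.minPlusPow_cover {h m K : ℕ} (hh : 0 < h) (hm : 0 < m) (hk : k ≤ K * m)
    (hB : Fintype.card (Option (Fin n × Fin (N + 1))) ≤ 2 ^ B) (hW : ∀ i, ZeroIffEq (W i))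
    (hN : ∀ i u v, W i u v ≠ ⊤ → W i u v ≤ N)
    (hN' : ∀ i u v, minPlusPow (W i) h u v ≠ ⊤ → minPlusPow (W i) h u v ≤ N)
    {U : Fin n → Finset (Fin n)} (hU : ∀ S : Finset (Fin n), S.card ≤ h → ∃ w, S ⊆ U w)
    (hU₁ : ∀ v, m * (Finset.univ.filter fun w => v ∈ U w).card ≤ n)
    (hU₂ : ∀ w, m * (U w).card ≤ 2 * n) :
    Reach B (fun i v => keepSmallest k (minPlusPow (W i) h v)) (16 * K) (Fin n → ℕ∞)
      (fun i v => keepSmallest k (W i v)) := by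
  classical
  obtain ⟨enc, dec, hdec⟩ := exists_code hB
  -- The element `(u, w, j)` is the `j`-th word exchanged between `u` and `w`: part of the row of
  -- `u` on the way to `w`, and part of the answer on the way back.
  let E := {x : Fin n × Fin n × Fin k // x.1 ∈ U x.2.1}
  have hload : ∀ a : ℕ, m * a ≤ 2 * n → a * k ≤ 2 * K * n := by
    intro a ha
    refine Nat.le_of_mul_le_mul_left ?_ hm
    calc m * (a * k) = m * a * k := by ring
      _ ≤ 2 * n * (K * m) := Nat.mul_le_mul ha hk
      _ = m * (2 * K * n) := by ring
  have hrow : ∀ v, (Finset.univ.filter fun e : E => e.1.1 = v).card ≤ 2 * K * n := by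
    intro v
    refine le_trans ?_ (hload _ ((hU₁ v).trans (by omega)))
    refine (Finset.card_le_card_of_injOn (t := (Finset.univ.filter fun w => v ∈ U w) ×ˢ Finset.univ)
      (fun e => e.1.2) ?_ ?_).trans_eq (by rw [Finset.card_product, Finset.card_fin])
    · intro e he
      have he := (Finset.mem_filter.1 he).2
      simpa [← he] using e.2
    · intro e he e' he' hee
      exact Subtype.ext (Prod.ext
        ((Finset.mem_filter.1 he).2.trans (Finset.mem_filter.1 he').2.symm) hee)
  have hcov : ∀ w, (Finset.univ.filter fun e : E => e.1.2.1 = w).card ≤ 2 * K * n := by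
    intro w
    refine le_trans ?_ (hload _ (hU₂ w))
    refine (Finset.card_le_card_of_injOn (t := U w ×ˢ Finset.univ)
      (fun e => (e.1.1, e.1.2.2)) ?_ ?_).trans_eq (by rw [Finset.card_product, Finset.card_fin])
    · intro e he
      have he := (Finset.mem_filter.1 he).2
      simpa [← he] using e.2
    · intro e he e' he' hee
      have hee := Prod.mk.inj hee
      exact Subtype.ext (Prod.ext hee.1 (Prod.ext
        ((Finset.mem_filter.1 he).2.trans (Finset.mem_filter.1 he').2.symm) hee.2))
  have collect : Reach B (fun i w => restrictRows (fun u => keepSmallest k (W i u)) (U w))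
      (4 * (2 * K)) (Fin n → ℕ∞) (fun i v => keepSmallest k (W i v)) := by
    refine (Reach.route (2 * K) (fun e : E => e.1.1) (fun e => e.1.2.1) hrow hcov _
      fun e s => enc (pack k N s e.1.2.2)).then_compute
      (fun w s u x => if hu : u ∈ U w then
        unpack (fun j => dec (s.2 ⟨(u, w, j), hu⟩)) x else ⊤) fun i w => ?_
    funext u x
    unfold restrictRows
    split_ifs with hu
    · simp only [if_true, hdec]
      exact (congrFun (unpack_pack_keepSmallest (hN i u)) x).symm
    · rfl
  have answer : Reach B (fun i v => keepSmallest k (minPlusPow (W i) h v)) (4 * (2 * K))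
      (Fin n → Fin n → ℕ∞)
      (fun i w => restrictRows (fun u => keepSmallest k (W i u)) (U w)) := by
    refine (Reach.route (2 * K) (fun e : E => e.1.2.1) (fun e => e.1.1) hcov hrow _
      fun e s => enc (pack k N (minPlusPow s h e.1.1) e.1.2.2)).then_compute
      (fun v s => keepSmallest k fun x => ⨅ (w : Fin n) (hv : v ∈ U w),
        unpack (fun j => dec (s.2 ⟨(v, w, j), hv⟩)) x) fun i v => ?_
    simp only [if_true, hdec]
    exact (keepSmallest_iInf_cover hh (hW i) (hN' i) hU v).symm
  have hT : 16 * K = 4 * (2 * K) + 4 * (2 * K) := by ring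
  rw [hT]
  exact collect.trans answer

/-- If `n ^ (1 / h) < 3`, then `k ≤ 3 * ⌈C⌉₊` and broadcasting is cheap enough. Otherwise `m = ⌊n ^
(1 / h) / 3⌋₊` is positive and admits a balanced cover. -/
theorem exists_reach_minPlusPow {h : ℕ} {C : ℝ} (hh : 0 < h)
    (hk : (k : ℝ) ≤ C * (n : ℝ) ^ (1 / (h : ℝ)))
    (hB : Fintype.card (Option (Fin n × Fin (N + 1))) ≤ 2 ^ B) (hW : ∀ i, ZeroIffEq (W i))
    (hN : ∀ i u v, W i u v ≠ ⊤ → W i u v ≤ N)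
    (hN' : ∀ i u v, minPlusPow (W i) h u v ≠ ⊤ → minPlusPow (W i) h u v ≤ N) :
    ∃ T ≤ 96 * ⌈C⌉₊, Reach B (fun i v => keepSmallest k (minPlusPow (W i) h v)) T (Fin n → ℕ∞)
      (fun i v => keepSmallest k (W i v)) := by
  have hx0 : 0 ≤ (n : ℝ) ^ (1 / (h : ℝ)) := Real.rpow_nonneg (Nat.cast_nonneg n) _
  have hxn : ((n : ℝ) ^ (1 / (h : ℝ))) ^ h = n := by
    rw [one_div]; exact Real.rpow_inv_natCast_pow (Nat.cast_nonneg n) hh.ne'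
  generalize (n : ℝ) ^ (1 / (h : ℝ)) = x at hk hx0 hxn
  have hk' : (k : ℝ) ≤ ⌈C⌉₊ * x := hk.trans (mul_le_mul_of_nonneg_right (Nat.le_ceil C) hx0)
  by_cases hx : x < 3
  · refine ⟨k, ?_, Reach.minPlusPow_broadcast h hB hW hN⟩
    have : (k : ℝ) ≤ (⌈C⌉₊ * 3 : ℕ) := by
      push_cast
      exact hk'.trans (mul_le_mul_of_nonneg_left hx.le (Nat.cast_nonneg _))
    have := Nat.cast_le.1 this
    omega
  · rw [not_lt] at hx
    have hm : 0 < ⌊x / 3⌋₊ := Nat.floor_pos.2 (by linarith)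
    have h1 : (⌊x / 3⌋₊ : ℝ) ≤ x / 3 := Nat.floor_le (by linarith)
    have h2 : x / 3 < ⌊x / 3⌋₊ + 1 := Nat.lt_floor_add_one _
    have hm' : (1 : ℝ) ≤ ⌊x / 3⌋₊ := by exact_mod_cast hm
    generalize ⌊x / 3⌋₊ = m at hm h1 h2 hm'
    have hmn : (3 * m) ^ h ≤ n := by
      have : (3 * m : ℝ) ^ h ≤ n := by
        rw [← hxn]
        exact pow_le_pow_left₀ (by positivity) (by linarith) h
      exact_mod_cast this
    -- From `x / 3 < m + 1 ≤ 2 * m`; the total of `96 = 16 * 6` follows.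
    have hkm : k ≤ 6 * ⌈C⌉₊ * m := by
      have : (k : ℝ) ≤ ⌈C⌉₊ * (6 * m) :=
        hk'.trans (mul_le_mul_of_nonneg_left (by linarith) (Nat.cast_nonneg _))
      have : k ≤ ⌈C⌉₊ * (6 * m) := by exact_mod_cast this
      calc k ≤ _ := this
        _ = _ := by ring
    obtain ⟨U, hU, hU₁, hU₂⟩ := exists_balanced_cover hh hm hmn
    exact ⟨16 * (6 * ⌈C⌉₊), by omega,
      Reach.minPlusPow_cover hh hm hkm hB hW hN hN' hU hU₁ hU₂⟩

end Step

/-! ### Iteration and conclusion -/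

/-- The nearest nodes for `h ^ i` hops, from the rows of the matrices of one-hop distances. -/
theorem exists_nearestHop_algorithm {c n k h : ℕ} {C : ℝ} (hh : 0 < h)
    (hk : (k : ℝ) ≤ C * (n : ℝ) ^ (1 / (h : ℝ))) (i : ℕ) {ι Input : Type}
    (G : ι → WDigraph n) (hG : ∀ a, (G a).WeightsLE (n ^ c)) (input : ι → Fin n → Input)
    (row : Fin n → Input → Fin n → ℕ∞) (hrow : ∀ a v, (G a).hopMatrix v = row v (input a v)) :
    ∃ (A : CliqueAlgorithm n (messageBits (c + 3) n) Input (Finset (Fin n × ℕ∞))) (T : ℕ),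
      T ≤ 96 * ⌈C⌉₊ * i ∧
        ∀ a v, A.outputAfter (input a) T v = (G a).nearestHopDistances k (h ^ i) v := by
  classical
  have reach : ∃ T ≤ 96 * ⌈C⌉₊ * i, Reach (messageBits (c + 3) n)
      (fun a v => keepSmallest k (minPlusPow (G a).hopMatrix (h ^ i) v)) T Input input := by
    -- Between iterations a node keeps only the `k` smallest entries of its row; the truncation
    -- property makes them enough for the next power.
    induction i with
    | zero =>
      refine ⟨0, Nat.zero_le _, .compute (fun v s => keepSmallest k (row v s)) fun a v => ?_⟩
      rw [pow_zero, minPlusPow_one, hrow]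
    | succ i ih =>
      obtain ⟨T, hT, hr⟩ := ih
      obtain ⟨T', hT', hr'⟩ := exists_reach_minPlusPow (N := n * n ^ c)
        (W := fun a => minPlusPow (G a).hopMatrix (h ^ i)) hh hk (card_word_le c n)
        (fun a => (G a).zeroIffEq_hopMatrix.minPlusPow _)
        (fun a u v => WDigraph.minPlusPow_hopMatrix_le_of_ne_top (hG a))
        (fun a u v => by
          rw [← minPlusPow_mul]
          exact WDigraph.minPlusPow_hopMatrix_le_of_ne_top (hG a))
      simp only [← minPlusPow_mul, ← pow_succ] at hr'
      exact ⟨T + T', by rw [Nat.mul_succ]; omega, hr.trans hr'⟩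
  obtain ⟨T, hT, hr⟩ := reach
  obtain ⟨A, hA⟩ := (hr.then_compute (ρ := fun a v => (G a).nearestHopDistances k (h ^ i) v)
    (fun _ r => (kSmallest k r).image fun u => (u, r u)) fun a v => by
      rw [kSmallest_keepSmallest, WDigraph.nearestHopDistances, WDigraph.kNearestHop,
        WDigraph.hopDist_eq_minPlusPow]
      refine Eq.trans ?_ (Finset.image_congr fun u hu =>
        congrArg (Prod.mk u) (keepSmallest_of_mem hu).symm)
      congr!).exists_algorithm
  exact ⟨A, T, hT, hA⟩

theorem lemma3p3 (c : ℕ) :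
    ∃ b : ℕ, ∀ C : ℝ, ∃ D : ℕ, ∀ n k h i : ℕ, 0 < k → 0 < h → 0 < i →
      (k : ℝ) ≤ C * (n : ℝ) ^ (1 / (h : ℝ)) →
      (∃ (A : CliqueAlgorithm n (messageBits b n) (IncidentEdges n × IncidentEdges n)
            (Finset (Fin n × ℕ∞))) (T : ℕ), T ≤ D * i ∧
          ∀ G H : WDigraph n, G.WeightsLE (n ^ c) → H.WeightsLE (n ^ c) →
            WDigraph.IsKNearestHopset k (h ^ i) G H →
            ∀ v : Fin n,
              A.outputAfter (fun u => (G.incident u, H.incident u)) T v =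
                G.nearestDistances k v) ∧
      (∃ (A : CliqueAlgorithm n (messageBits b n) (IncidentEdges n)
            (Finset (Fin n × ℕ∞))) (T : ℕ), T ≤ D * i ∧
          ∀ G : WDigraph n, G.WeightsLE (n ^ c) →
            ∀ v : Fin n,
              A.outputAfter (fun u => G.incident u) T v =
                G.nearestHopDistances k (h ^ i) v) := by
  refine ⟨c + 3, fun C => ⟨96 * ⌈C⌉₊, fun n k h i _ hh _ hk => ⟨?_, ?_⟩⟩⟩
  -- The algorithm finds hop distances in the union of any two graphs with bounded weights; the
  -- hopset property enters only in identifying the output.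
  · obtain ⟨A, T, hT, hA⟩ := exists_nearestHop_algorithm hh hk i
      (ι := {p : WDigraph n × WDigraph n // p.1.WeightsLE (n ^ c) ∧ p.2.WeightsLE (n ^ c)})
      (fun p => p.1.1.union p.1.2) (fun p => WDigraph.weightsLE_union p.2.1 p.2.2)
      (fun p v => (p.1.1.incident v, p.1.2.incident v))
      (fun v s u => if v = u then 0 else min (s.1.outgoing u) (s.2.outgoing u)) fun _ _ => rfl
    refine ⟨A, T, hT, fun G H hG hH hGH v => ?_⟩
    rw [hGH.nearestDistances_eq]
    exact hA ⟨(G, H), hG, hH⟩ v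
  · obtain ⟨A, T, hT, hA⟩ := exists_nearestHop_algorithm hh hk i
      (ι := {G : WDigraph n // G.WeightsLE (n ^ c)}) (fun G => G.1) (fun G => G.2)
      (fun G v => G.1.incident v) (fun v s u => if v = u then 0 else s.outgoing u) fun _ _ => rfl
    exact ⟨A, T, hT, fun G hG v => hA ⟨G, hG⟩ v⟩
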